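/- Let $K=\mathbb{F}_q$ be a finite field with $q$ elements, let $n\ge 0$ and $s\ge 1$ be integers, let $v_1,\ldots,v_s\in\mathbb{Z}^n$ with $v_i=(v_{i1},\ldots,v_{in})$, and put $\mathcal{B}=\{(v_1,1),\ldots,(v_s,1)\}\subset\mathbb{Z}^{n+1}$. Let $S=K[t_1,\ldots,t_s]$, let $$X=\{[(x_1^{v_{11}}\cdots x_n^{v_{1n}},\ldots,x_1^{v_{s1}}\cdots x_n^{v_{sn}})] \mid x_1,\ldots,x_n\in K\setminus\{0\}\}\subset\mathbb{P}^{s-1}$$ be the algebraic toric set over $K$ parameterized by the Laurent monomials $y^{v_1},\ldots,y^{v_s}$, and let $I(X)\subset S$ be the ideal generated by the homogeneous polynomials that vanish on $X$. Let $$I_{\mathcal{B}}=\Bigl(t^a-t^b \Bigm| a,b\in\mathbb{N}^s,\ \sum_i a_i(v_i,1)=\sum_i b_i(v_i,1)\Bigr)\subset S$$ be the toric ideal of $\mathcal{B}$. For an ideal $Q\subset S$ and $h\in S$ write $(Q\colon h^\infty)=\{f\in S\mid fh^m\in Q\text{ for some }m\ge 1\}$. Let $\mathbb{Z}\mathcal{B}$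 be the subgroup of $\mathbb{Z}^{n+1}$ generated by $\mathcal{B}$, and for a $\mathbb{Z}$-module $M$ let $\mathcal{Z}(M)=\{r\in\mathbb{Z}\mid rm=0\text{ for some }0\ne m\in M\}$. Then: (a) $\bigl(I_{\mathcal{B}}+(t_2^{q-1}-t_1^{q-1},\ldots,t_s^{q-1}-t_1^{q-1})\colon (t_1\cdots t_s)^\infty\bigr)\subset I(X)$. (b) Equality in (a) holds if and only if $q-1\notin\mathcal{Z}(\mathbb{Z}^{n+1}/\mathbb{Z}\mathcal{B})$. (c) Let $p_1,\ldots,p_m$ be the prime numbers (if any) that divide some invariant factor of $\mathbb{Z}^{n+1}/\mathbb{Z}\mathcal{B}$, that is, some $d_i$ in a decomposition $\mathbb{Z}^{n+1}/\mathbb{Z}\mathcal{B}\simeq\mathbb{Z}^{r}\times\mathbb{Z}/d_1\times\cdots\times\mathbb{Z}/d_k$ with all $d_i>1$ and $d_1\mid d_2\mid\cdots\mid d_k$. Equality in (a) holds if and only if $\mathbb{Z}^{n+1}/\mathbb{Z}\mathcal{B}$ is torsion-free or $q\not\equiv 1 \pmod{p_i}$ for all $i$. -/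

import Mathlib

open MvPolynomial

namespace ToricSet

/-- The set `𝒵_D(M)` of zero divisors of a `D`-module `M`. -/
def zeroDivisors (D : Type*) [CommRing D] (M : Type*) [AddCommGroup M] [Module D M] : Set D :=
  {r | ∃ m : M, m ≠ 0 ∧ r • m = 0}

/-- `d 0 ∣ d 1 ∣ ⋯ ∣ d (k - 1)`, all greater than `1`, are the invariant factors of the finitely
generated abelian group `M`: one has `M ≅ ℤ^r × ℤ/d 0 × ⋯ × ℤ/d (k - 1)` for some `r`. -/
def IsInvariantFactors (M : Type*) [AddCommGroup M] {k : ℕ} (d : Fin k → ℕ) : Prop :=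
  (∀ i, 1 < d i) ∧ (∀ i j, i ≤ j → d i ∣ d j) ∧
    ∃ r : ℕ, Nonempty (M ≃+ (Fin r → ℤ) × ((i : Fin k) → ZMod (d i)))

/-- The prime numbers that occur in the factorizations of the invariant factors of `M`. -/
def invariantFactorPrimes (M : Type*) [AddCommGroup M] : Set ℕ :=
  {p | p.Prime ∧ ∃ (k : ℕ) (d : Fin k → ℕ), IsInvariantFactors M d ∧ ∃ i, p ∣ d i}

/-- The subgroup `ℤ𝒜` of `ℤ^n` generated by `v_1, …, v_s`. -/
def lattice {s n : ℕ} (v : Fin s → Fin n → ℤ) : Submodule ℤ (Fin n → ℤ) :=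
  Submodule.span ℤ (Set.range v)

/-- The lifted vectors `(v_i, 1)` in `ℤ^(n+1)`. -/
def lift {s n : ℕ} (v : Fin s → Fin n → ℤ) : Fin s → Fin (n + 1) → ℤ :=
  fun i => Fin.snoc (α := fun _ => ℤ) (v i) 1

/-- The saturation `(Q : h^∞)` of an ideal `Q` with respect to an element `h`. -/
def saturation {R : Type*} [CommRing R] (Q : Ideal R) (h : R) : Ideal R where
  carrier := {f | ∃ m : ℕ, 1 ≤ m ∧ f * h ^ m ∈ Q}
  zero_mem' := ⟨1, le_refl 1, by simp⟩
  add_mem' := by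
    rintro a b ⟨m, hm, ha⟩ ⟨k, _, hb⟩
    refine ⟨m + k, by omega, ?_⟩
    have e : (a + b) * h ^ (m + k) = h ^ k * (a * h ^ m) + h ^ m * (b * h ^ k) := by ring
    rw [e]
    exact Q.add_mem (Q.mul_mem_left _ ha) (Q.mul_mem_left _ hb)
  smul_mem' := by
    rintro c a ⟨m, hm, ha⟩
    refine ⟨m, hm, ?_⟩
    rw [smul_eq_mul, mul_assoc]
    exact Q.mul_mem_left _ ha

section
variable (K : Type*) [Field K]

/-- The toric ideal of `w_1, …, w_s` in `K[t_1, …, t_s]`: it is generated by the binomials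
`t^a - t^b` with `∑ a_i w_i = ∑ b_i w_i`. -/
noncomputable def toricIdeal {s n : ℕ} (w : Fin s → Fin n → ℤ) : Ideal (MvPolynomial (Fin s) K) :=
  Ideal.span {f | ∃ a b : Fin s →₀ ℕ, ∑ i, a i • w i = ∑ i, b i • w i ∧
    f = monomial a (1 : K) - monomial b (1 : K)}

/-- The ideal `(t_i^e - t_1^e : 2 ≤ i ≤ s)` of `K[t_1, …, t_s]`. -/
noncomputable def powerDifferenceIdeal (s : ℕ) [NeZero s] (e : ℕ) :
    Ideal (MvPolynomial (Fin s) K) :=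
  Ideal.span {f | ∃ i : Fin s, i ≠ 0 ∧ f = X i ^ e - X 0 ^ e}

/-- The ideal generated by the homogeneous polynomials that vanish on a subset of the
projective space over `K`. -/
noncomputable def vanishingIdeal {s : ℕ} (Y : Set (Projectivization K (Fin s → K))) :
    Ideal (MvPolynomial (Fin s) K) :=
  Ideal.span {f | (∃ d : ℕ, f.IsHomogeneous d) ∧
    ∀ (x : Fin s → K) (hx : x ≠ 0), Projectivization.mk K x hx ∈ Y → eval x f = 0}

variable {K}

/-- The point `(x^(v_1), …, x^(v_s))` of `K^s`, for `x` in `(K^*)^n`. -/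
def monomialPoint {s n : ℕ} (v : Fin s → Fin n → ℤ) (x : Fin n → Kˣ) : Fin s → K :=
  fun i => ((∏ j, x j ^ v i j : Kˣ) : K)

theorem monomialPoint_ne_zero {s n : ℕ} [NeZero s] (v : Fin s → Fin n → ℤ) (x : Fin n → Kˣ) :
    monomialPoint v x ≠ 0 :=
  fun h => Units.ne_zero _ (congrFun h 0)

variable (K)

/-- The algebraic toric set in the projective space `ℙ^(s-1)` parameterized by the Laurent
monomials `y^(v_1), …, y^(v_s)`. -/
def algebraicToricSet {s n : ℕ} [NeZero s] (v : Fin s → Fin n → ℤ) :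
    Set (Projectivization K (Fin s → K)) :=
  Set.range fun x : Fin n → Kˣ =>
    Projectivization.mk K (monomialPoint v x) (monomialPoint_ne_zero v x)

/-- The saturation of `I_ℬ + (t_2^(q-1) - t_1^(q-1), …, t_s^(q-1) - t_1^(q-1))` with respect to
`t_1 ⋯ t_s`, where `ℬ = {(v_1, 1), …, (v_s, 1)}`. -/
noncomputable def saturatedIdeal {s n : ℕ} [NeZero s] (q : ℕ) (v : Fin s → Fin n → ℤ) :
    Ideal (MvPolynomial (Fin s) K) :=
  saturation (toricIdeal K (lift v) + powerDifferenceIdeal K s (q - 1)) (∏ i, X i)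

end

end ToricSet

/-!
Both ideals in the theorem are generated by binomials `t^a - t^b` with `a - b` in a lattice, so that
the theorem becomes a comparison of two lattices in `ℤ^s`. Write `φ c = ∑ c_i (v_i, 1)`.

* The saturated ideal belongs to `L' = {c | φ c = (q - 1) φ d for some d with ∑ d_i = 0}`
  (`saturatedIdeal_eq_span`). Grading `S` by `ℤ^s / L'` kills the generators and makes `t_1 ⋯ t_s`
  a unit, so the saturated ideal is no larger; after localizing at `t_1 ⋯ t_s` the defining
  relations can be composed and inverted, so it is no smaller.
* The vanishing ideal belongs to `L = {c | ∑ c_i = 0 and ∑ c_i v_i ∈ (q - 1) ℤ^n}`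
  (`binomial_mem_vanishingIdeal`, `vanishingIdeal_le`). A polynomial restricted to the toric set is
  a combination of characters of `(K^*)^n`. Distinct characters are linearly independent, and two
  exponents give the same character exactly when they agree modulo `q - 1`, since `K^*` is cyclic.
  In both cases `mem_span_binomials` turns vanishing coefficient sums into binomials.

Clearly `L' ⊆ L`. The elements `c` of `L` are those with `φ c = (q - 1) (u, 0)` for some `u`, and
`c ∈ L'` means that `(u, 0) ∈ ℤℬ`. Hence `L = L'` says that no `(u, 0)` outside `ℤℬ` is moved into
`ℤℬ` by `q - 1`; subtracting a multiple of `(v_1, 1)` makes this a statement about all of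
`ℤ^(n+1)`, namely that `q - 1` is not a zero divisor on `ℤ^(n+1) / ℤℬ`.

The criterion by invariant factors follows once invariant factors are known to exist
(`exists_isInvariantFactors`): the primary decomposition is regrouped by sorting, for each prime,
the exponents that occur. On `ℤ^r × ∏ ℤ/d_i` the nonzero integer `q - 1` is a zero divisor exactly
when it shares a prime factor with some `d_i`.
-/

open MvPolynomial

namespace ToricSet

/-! ### Invariant factors -/

/-- A finite product of cyclic groups of prime power order is a product of cyclic groups whose
orders form a divisibility chain: sort the exponents belonging to each prime. -/
theorem exists_dvd_chain_addEquiv {k : ℕ} (p e : Fin k → ℕ) (hp : ∀ i, (p i).Prime) :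
    ∃ D : Fin k → ℕ, (∀ i, D i ≠ 0) ∧ (∀ i j, i ≤ j → D i ∣ D j) ∧
      Nonempty (((i : Fin k) → ZMod (p i ^ e i)) ≃+ ((i : Fin k) → ZMod (D i))) := by
  classical
  let P := {x // x ∈ Finset.univ.image p}
  let _ : Fintype P := Finset.Subtype.fintype (Finset.univ.image p)
  have hP : ∀ x : P, (x : ℕ).Prime := by
    rintro ⟨x, hx⟩
    obtain ⟨i, -, rfl⟩ := Finset.mem_image.1 hx
    exact hp i
  have hcop : ∀ f : P → ℕ, Pairwise (Function.onFun Nat.Coprime fun x : P => (x : ℕ) ^ f x) :=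
    fun f x y hxy => Nat.coprime_pow_primes _ _ (hP x) (hP y) fun h => hxy (Subtype.ext h)
  let E : P → Fin k → ℕ := fun x i => if p i = x then e i else 0
  have hE : ∀ i, p i ^ e i = ∏ x : P, (x : ℕ) ^ E x i := fun i => by
    rw [Finset.prod_eq_single ⟨p i, Finset.mem_image_of_mem _ (Finset.mem_univ i)⟩]
    · simp [E]
    · intro x _ hx
      have : p i ≠ x := fun h => hx (Subtype.ext h.symm)
      simp [E, this]
    · simp
  refine ⟨fun j => ∏ x : P, (x : ℕ) ^ E x (Tuple.sort (E x) j),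
    fun j => Finset.prod_ne_zero_iff.2 fun x _ => pow_ne_zero _ (hP x).ne_zero,
    fun i j hij => Finset.prod_dvd_prod_of_dvd _ _ fun x _ =>
      pow_dvd_pow _ (Tuple.monotone_sort (E x) hij), ⟨?_⟩⟩
  let e₁ : ((i : Fin k) → ZMod (p i ^ e i)) ≃+ ((i : Fin k) → (x : P) → ZMod ((x : ℕ) ^ E x i)) :=
    AddEquiv.piCongrRight fun i => ((ZMod.ringEquivCongr (hE i)).trans
      (ZMod.prodEquivPi _ (hcop fun x => E x i))).toAddEquiv
  let e₂ : ((i : Fin k) → (x : P) → ZMod ((x : ℕ) ^ E x i)) ≃+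
      ((j : Fin k) → (x : P) → ZMod ((x : ℕ) ^ E x (Tuple.sort (E x) j))) :=
    { toFun := fun f j x => f (Tuple.sort (E x) j) x
      invFun := fun f => fun i x =>
        (Equiv.piCongrLeft (fun i => ZMod ((x : ℕ) ^ E x i)) (Tuple.sort (E x))) (fun j => f j x) i
      left_inv := fun f => by
        ext i x
        obtain ⟨j, rfl⟩ := (Tuple.sort (E x)).surjective i
        simp [Equiv.piCongrLeft_apply_apply]
      right_inv := fun f => by
        ext j x
        simp [Equiv.piCongrLeft_apply_apply]
      map_add' := fun f g => rfl }
  let e₃ : ((j : Fin k) → (x : P) → ZMod ((x : ℕ) ^ E x (Tuple.sort (E x) j))) ≃+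
      ((j : Fin k) → ZMod (∏ x : P, (x : ℕ) ^ E x (Tuple.sort (E x) j))) :=
    AddEquiv.piCongrRight fun j =>
      (ZMod.prodEquivPi _ (hcop fun x => E x (Tuple.sort (E x) j))).symm.toAddEquiv
  exact (e₁.trans e₂).trans e₃

/-- Trivial factors `ZMod 1` can be dropped from a product of cyclic groups without destroying
the divisibility chain of the orders. -/
theorem exists_addEquiv_one_lt {k : ℕ} (D : Fin k → ℕ) (hD : ∀ i, D i ≠ 0)
    (hdvd : ∀ i j, i ≤ j → D i ∣ D j) :
    ∃ (l : ℕ) (d : Fin l → ℕ), (∀ i, 1 < d i) ∧ (∀ i j, i ≤ j → d i ∣ d j) ∧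
      Nonempty (((i : Fin k) → ZMod (D i)) ≃+ ((i : Fin l) → ZMod (d i))) := by
  classical
  let s : Finset (Fin k) := Finset.univ.filter fun i => 1 < D i
  let o := s.orderIsoOfFin rfl
  refine ⟨s.card, fun i => D (o i), fun i => (Finset.mem_filter.1 (o i).2).2,
    fun i j hij => hdvd _ _ (o.monotone hij), ⟨?_⟩⟩
  let F : ((i : Fin k) → ZMod (D i)) →+ ((i : Fin s.card) → ZMod (D (o i))) :=
    { toFun := fun f i => f (o i)
      map_zero' := rfl
      map_add' := fun _ _ => rfl }
  refine AddEquiv.ofBijective F ⟨(injective_iff_map_eq_zero F).2 fun f hf => ?_, fun g => ?_⟩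
  · funext i
    by_cases hi : i ∈ s
    · obtain ⟨j, hj⟩ := o.surjective ⟨i, hi⟩
      obtain rfl : ((o j : s) : Fin k) = i := congrArg Subtype.val hj
      exact congrFun hf j
    · have h1 : D i = 1 := by
        have := hD i
        have h' : ¬ 1 < D i := fun h => hi (Finset.mem_filter.2 ⟨Finset.mem_univ _, h⟩)
        omega
      have : Subsingleton (ZMod (D i)) := by rw [h1]; infer_instance
      exact Subsingleton.elim _ _
  · refine ⟨fun i => if hi : i ∈ s then
      (Equiv.piCongrLeft (fun x : s => ZMod (D x)) o.toEquiv) g ⟨i, hi⟩ else 0, ?_⟩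
    funext j
    have := Equiv.piCongrLeft_apply_apply (fun x : s => ZMod (D x)) o.toEquiv g j
    simp only [F, AddMonoidHom.coe_mk, ZeroHom.coe_mk]
    rw [dif_pos (o j).2]
    exact this

theorem exists_isInvariantFactors (M : Type*) [AddCommGroup M] [AddGroup.FG M] :
    ∃ (k : ℕ) (d : Fin k → ℕ), IsInvariantFactors M d := by
  obtain ⟨r, ι, _, p, hp, e, ⟨f⟩⟩ := AddCommGroup.equiv_free_prod_directSum_zmod M
  let σ := Fintype.equivFin ι
  obtain ⟨D, hD, hdvd, ⟨g⟩⟩ := exists_dvd_chain_addEquiv (p ∘ σ.symm) (e ∘ σ.symm)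
    fun i => hp _
  obtain ⟨l, d, hd, hdvd', ⟨h⟩⟩ := exists_addEquiv_one_lt D hD hdvd
  let t : ((i : ι) → ZMod (p i ^ e i)) ≃+
      ((i : Fin (Fintype.card ι)) → ZMod ((p ∘ σ.symm) i ^ (e ∘ σ.symm) i)) :=
    { Equiv.piCongrLeft' (fun i => ZMod (p i ^ e i)) σ with
      map_add' := fun _ _ => rfl }
  refine ⟨l, d, hd, hdvd', r, ⟨f.trans (AddEquiv.prodCongr ?_ ?_)⟩⟩
  · exact (Finsupp.linearEquivFunOnFinite ℤ ℤ (Fin r)).toAddEquiv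
  · exact (((DirectSum.addEquivProd _).trans t).trans g).trans h

/-- A nonzero integer `m` kills a nonzero element of a finitely generated abelian group exactly
when one of the primes dividing the invariant factors divides `m`. -/
theorem mem_zeroDivisors_iff_exists_prime (M : Type*) [AddCommGroup M] [AddGroup.FG M] {m : ℕ}
    (hm : m ≠ 0) :
    (m : ℤ) ∈ zeroDivisors ℤ M ↔ ∃ p ∈ invariantFactorPrimes M, p ∣ m := by
  classical
  constructor
  · rintro ⟨x, hx, hmx⟩
    obtain ⟨k, d, hd⟩ := exists_isInvariantFactors M
    obtain ⟨h1, -, r, ⟨f⟩⟩ := id hd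
    have hf : (m : ℤ) • f x = 0 := by rw [← map_zsmul, hmx, map_zero]
    have hfree : (f x).1 = 0 := by
      have : (m : ℤ) • (f x).1 = 0 := congrArg Prod.fst hf
      exact (smul_eq_zero.1 this).resolve_left (by exact_mod_cast hm)
    obtain ⟨i, hi⟩ : ∃ i, (f x).2 i ≠ 0 := by
      by_contra! h
      exact hx (f.injective (by rw [map_zero]; exact Prod.ext hfree (funext h)))
    have hmi : (m : ZMod (d i)) * (f x).2 i = 0 := by
      have : ((m : ℤ) • (f x).2) i = 0 := congrFun (congrArg Prod.snd hf) i
      simpa [zsmul_eq_mul] using this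
    have hnc : ¬ Nat.Coprime m (d i) := fun hc =>
      hi (((ZMod.isUnit_iff_coprime m (d i)).2 hc).mul_right_eq_zero.1 hmi)
    obtain ⟨p, hp, hpm, hpd⟩ := Nat.Prime.not_coprime_iff_dvd.1 hnc
    exact ⟨p, ⟨hp, k, d, hd, i, hpd⟩, hpm⟩
  · rintro ⟨p, ⟨hp, k, d, ⟨h1, -, r, ⟨f⟩⟩, i, c, hc⟩, b, rfl⟩
    let y : (Fin r → ℤ) × ((i : Fin k) → ZMod (d i)) := (0, Pi.single i (c : ZMod (d i)))
    have hc0 : (c : ZMod (d i)) ≠ 0 := by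
      rw [Ne, ZMod.natCast_eq_zero_iff]
      intro hdc
      have hcpos : 0 < c := Nat.pos_of_ne_zero fun h => by
        have := h1 i
        simp [hc, h] at this
      have := Nat.le_of_dvd hcpos hdc
      have := hp.two_le
      nlinarith
    refine ⟨f.symm y, fun h => hc0 ?_, f.injective ?_⟩
    · have : y = 0 := by simpa using h
      simpa [y] using congrFun (congrArg Prod.snd this) i
    · rw [map_zsmul, f.apply_symm_apply, map_zero]
      have : ((p * b : ℕ) : ZMod (d i)) * (c : ZMod (d i)) = 0 := by
        rw [← Nat.cast_mul, ZMod.natCast_eq_zero_iff, hc]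
        exact ⟨b, by ring⟩
      refine Prod.ext (by simp [y]) ?_
      change ((p * b : ℕ) : ℤ) •
        (Pi.single i (c : ZMod (d i)) : (i : Fin k) → ZMod (d i)) = 0
      rw [← Pi.single_smul, zsmul_eq_mul, Int.cast_natCast, this, Pi.single_zero]

/-! ### Binomials and fibres -/

/-- If the coefficients of `f` add up to zero over each fibre of a function `g` on the exponents,
then `f` is a combination of binomials `t^a - t^b` with `g a = g b` whose two terms occur in `f`:
subtract from each term the same multiple of a chosen monomial in its fibre. -/
theorem mem_span_binomials {K σ T : Type*} [Field K] [DecidableEq T] (g : (σ →₀ ℕ) → T)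
    (f : MvPolynomial σ K) (hf : ∀ t, ∑ a ∈ f.support with g a = t, coeff a f = 0) :
    f ∈ Ideal.span {h | ∃ a ∈ f.support, ∃ b ∈ f.support, g a = g b ∧
      h = monomial a (1 : K) - monomial b (1 : K)} := by
  classical
  have hr : ∀ t, ∃ b, (∃ a ∈ f.support, g a = t) → b ∈ f.support ∧ g b = t := fun t => by
    by_cases h : ∃ a ∈ f.support, g a = t
    · obtain ⟨a, ha⟩ := h
      exact ⟨a, fun _ => ha⟩
    · exact ⟨0, fun h' => absurd h' h⟩
  choose r hr using hr
  have hzero : ∑ a ∈ f.support, monomial (r (g a)) (coeff a f) = 0 := by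
    rw [← Finset.sum_fiberwise_of_maps_to (t := f.support.image g)
      fun a ha => Finset.mem_image_of_mem g ha]
    refine Finset.sum_eq_zero fun t _ => ?_
    rw [Finset.sum_congr rfl (g := fun a => monomial (r t) (coeff a f)), ← map_sum, hf t, map_zero]
    intro a ha
    rw [(Finset.mem_filter.1 ha).2]
  have hsum : f = ∑ a ∈ f.support, C (coeff a f) *
      (monomial a (1 : K) - monomial (r (g a)) (1 : K)) := by
    simp only [mul_sub, C_mul_monomial, mul_one, Finset.sum_sub_distrib, hzero, sub_zero]
    exact f.as_sum
  rw [hsum]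
  refine Ideal.sum_mem _ fun a ha => Ideal.mul_mem_left _ _ (Ideal.subset_span ?_)
  rw [← hsum]
  obtain ⟨h1, h2⟩ := hr (g a) ⟨a, ha, rfl⟩
  exact ⟨a, ha, r (g a), h1, h2.symm, rfl⟩

/-- The grading homomorphism `K[t_1, …, t_s] → K[G]` that sends `t_i` to the group element `g i`. -/
noncomputable def gradingHom (K : Type*) [Field K] {σ G : Type*} [AddCommGroup G] (g : σ → G) :
    MvPolynomial σ K →ₐ[K] AddMonoidAlgebra K G :=
  aeval fun i => AddMonoidAlgebra.single (g i) 1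

theorem gradingHom_monomial {K : Type*} [Field K] {σ G : Type*} [Fintype σ] [AddCommGroup G]
    (g : σ → G) (a : σ →₀ ℕ) (c : K) :
    gradingHom K g (monomial a c) = AddMonoidAlgebra.single (∑ i, a i • g i) c := by
  classical
  have hprod : ∀ t : Finset σ, ∏ i ∈ t, (AddMonoidAlgebra.single (g i) (1 : K)) ^ a i =
      AddMonoidAlgebra.single (∑ i ∈ t, a i • g i) 1 := fun t => by
    induction t using Finset.induction_on with
    | empty => rfl
    | insert i t hi ih =>
      rw [Finset.prod_insert hi, ih, Finset.sum_insert hi, AddMonoidAlgebra.single_pow,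
        AddMonoidAlgebra.single_mul_single, one_pow, one_mul]
  rw [gradingHom, aeval_monomial, Finsupp.prod_fintype _ _ fun i => pow_zero _, hprod,
    ← Algebra.smul_def, AddMonoidAlgebra.smul_single, smul_eq_mul, mul_one]

theorem sum_coeff_fiber_of_gradingHom_eq_zero {K : Type*} [Field K] {σ G : Type*} [Fintype σ]
    [AddCommGroup G] [DecidableEq G] (g : σ → G) {f : MvPolynomial σ K} (hf : gradingHom K g f = 0)
    (t : G) : ∑ a ∈ f.support with ∑ i, a i • g i = t, coeff a f = 0 := by
  rw [f.as_sum, map_sum] at hf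
  simp only [gradingHom_monomial] at hf
  have h := DFunLike.congr_fun (congrArg AddMonoidAlgebra.coeff hf) t
  rw [AddMonoidAlgebra.coeff_sum, Finsupp.finsetSum_apply] at h
  simp only [AddMonoidAlgebra.coeff_single, Finsupp.single_apply] at h
  rw [Finset.sum_filter]
  simpa using h

/-! ### The saturated ideal is a lattice ideal -/

section Lattice

variable {s n : ℕ}

/-- The lattice `{c | ∃ d, ∑ d_i = 0 ∧ φ c = e • φ d}` in `ℤ^s`, where `φ c = ∑ c_i (v_i, 1)`.
For `e = q - 1` it is the lattice of the saturated ideal. -/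
def powerLattice (v : Fin s → Fin n → ℤ) (e : ℕ) : Submodule ℤ (Fin s → ℤ) :=
  ((LinearMap.ker (Fintype.linearCombination ℤ (fun _ : Fin s => (1 : ℤ)))).map
    ((e : ℤ) • Fintype.linearCombination ℤ (lift v))).comap (Fintype.linearCombination ℤ (lift v))

theorem mem_powerLattice {v : Fin s → Fin n → ℤ} {e : ℕ} {c : Fin s → ℤ} :
    c ∈ powerLattice v e ↔
      ∃ d : Fin s → ℤ, ∑ i, d i = 0 ∧ ∑ i, c i • lift v i = (e : ℤ) • ∑ i, d i • lift v i := by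
  simp [powerLattice, Fintype.linearCombination_apply, eq_comm]

/-- The difference `a - b` of two exponents, an element of `ℤ^s`. -/
def expDiff (a b : Fin s →₀ ℕ) : Fin s → ℤ := fun i => (a i : ℤ) - b i

theorem sum_expDiff_smul {M : Type*} [AddCommGroup M] (a b : Fin s →₀ ℕ) (w : Fin s → M) :
    ∑ i, expDiff a b i • w i = ∑ i, a i • w i - ∑ i, b i • w i := by
  simp [expDiff, sub_smul]

theorem exists_expDiff_eq (c : Fin s → ℤ) : ∃ a b : Fin s →₀ ℕ, expDiff a b = c :=
  ⟨Finsupp.equivFunOnFinite.symm fun i => (c i).toNat,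
    Finsupp.equivFunOnFinite.symm fun i => (-c i).toNat, by
      funext i
      simp [expDiff]⟩

theorem sum_smul_mk_eq_iff (v : Fin s → Fin n → ℤ) (e : ℕ) (a b : Fin s →₀ ℕ) :
    ∑ i, a i • (powerLattice v e).mkQ (Pi.single i 1) =
        ∑ i, b i • (powerLattice v e).mkQ (Pi.single i 1) ↔
      expDiff a b ∈ powerLattice v e := by
  have h : expDiff a b = ∑ i, a i • (Pi.single i 1 : Fin s → ℤ) -
      ∑ i, b i • (Pi.single i 1 : Fin s → ℤ) := by
    rw [← sum_expDiff_smul]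
    funext j
    simp [Finset.sum_apply, Pi.single_apply]
  rw [h, ← Submodule.Quotient.eq]
  simp only [← map_nsmul, ← map_sum]
  rfl

variable (K : Type*) [Field K]

/-- The grading by `ℤ^s` modulo the lattice kills the saturated ideal: it kills the generators, and
it maps `t_1 ⋯ t_s` to a unit. -/
theorem gradingHom_eq_zero_of_mem_saturatedIdeal [NeZero s] (q : ℕ) (v : Fin s → Fin n → ℤ)
    {f : MvPolynomial (Fin s) K} (hf : f ∈ saturatedIdeal K q v) :
    gradingHom K (fun i => (powerLattice v (q - 1)).mkQ (Pi.single i 1)) f = 0 := by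
  set ψ := gradingHom K (fun i => (powerLattice v (q - 1)).mkQ (Pi.single i 1)) with hψ
  have hbin : ∀ a b : Fin s →₀ ℕ, expDiff a b ∈ powerLattice v (q - 1) →
      ψ (monomial a 1 - monomial b 1) = 0 := fun a b h => by
    rw [map_sub, gradingHom_monomial, gradingHom_monomial, (sum_smul_mk_eq_iff v _ a b).2 h,
      sub_self]
  have hle : toricIdeal K (lift v) + powerDifferenceIdeal K s (q - 1) ≤ RingHom.ker ψ := by
    refine sup_le (Ideal.span_le.2 ?_) (Ideal.span_le.2 ?_)
    · rintro _ ⟨a, b, hab, rfl⟩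
      refine hbin a b (mem_powerLattice.2 ⟨0, by simp, ?_⟩)
      rw [sum_expDiff_smul, hab, sub_self]
      simp
    · rintro _ ⟨i, -, rfl⟩
      rw [X_pow_eq_monomial, X_pow_eq_monomial]
      refine hbin _ _ (mem_powerLattice.2 ⟨Pi.single i 1 - Pi.single 0 1, by simp, ?_⟩)
      rw [Finset.smul_sum]
      refine Finset.sum_congr rfl fun j _ => ?_
      rw [smul_smul]
      congr 1
      generalize q - 1 = e
      simp [expDiff, Finsupp.single_apply, Pi.single_apply, mul_sub, eq_comm]
  obtain ⟨m, -, hm⟩ := hf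
  have h := hle hm
  rw [RingHom.mem_ker, map_mul, map_pow] at h
  have hu : IsUnit (ψ (∏ i, X i)) := by
    rw [map_prod]
    refine IsUnit.prod_univ_iff.2 fun i => ?_
    rw [hψ, gradingHom, aeval_X]
    exact IsUnit.of_mul_eq_one (AddMonoidAlgebra.single
      (-(powerLattice v (q - 1)).mkQ (Pi.single i 1)) 1) (by
        rw [AddMonoidAlgebra.single_mul_single, add_neg_cancel, one_mul]; rfl)
  exact (hu.pow m).mul_left_eq_zero.1 h

theorem prod_zpow_eq_zpow_sum {ι G : Type*} [CommGroup G] (t : Finset ι) (d : ι → ℤ) (x : G) :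
    ∏ i ∈ t, x ^ d i = x ^ ∑ i ∈ t, d i := by
  classical
  induction t using Finset.induction_on with
  | empty => simp
  | insert i t hi ih => rw [Finset.prod_insert hi, ih, Finset.sum_insert hi, zpow_add]

/-- In the localization of `S / Q` at `t_1 ⋯ t_s` the variables become units, so that the relations
defining `Q` can be composed and inverted. -/
theorem binomial_mem_saturatedIdeal [NeZero s] (q : ℕ) (v : Fin s → Fin n → ℤ)
    {a b : Fin s →₀ ℕ} (hab : expDiff a b ∈ powerLattice v (q - 1)) :
    monomial a (1 : K) - monomial b (1 : K) ∈ saturatedIdeal K q v := by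
  set Q := toricIdeal K (lift v) + powerDifferenceIdeal K s (q - 1)
  set h : MvPolynomial (Fin s) K := ∏ i, X i
  let L := Localization.Away (Ideal.Quotient.mk Q h)
  let θ : MvPolynomial (Fin s) K →+* L := (algebraMap _ L).comp (Ideal.Quotient.mk Q)
  have hθQ : ∀ f ∈ Q, θ f = 0 := fun f hf => by
    simp [θ, Ideal.Quotient.eq_zero_iff_mem.2 hf]
  have hunit : ∀ i, IsUnit (θ (X i)) := fun i => by
    have hu : IsUnit (∏ i, θ (X i)) := by
      rw [← map_prod]
      exact IsLocalization.Away.algebraMap_isUnit (Ideal.Quotient.mk Q h)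
    exact IsUnit.prod_univ_iff.1 hu i
  choose u hu using hunit
  have hmon : ∀ a : Fin s →₀ ℕ, θ (monomial a 1) = ((∏ i, u i ^ a i : Lˣ) : L) := fun a => by
    rw [monomial_eq, map_one, one_mul, Finsupp.prod_fintype _ _ fun i => pow_zero _, map_prod]
    simp [hu]
  let U : Multiplicative (Fin s → ℤ) →* Lˣ :=
    { toFun := fun c => ∏ i, u i ^ c.toAdd i
      map_one' := by simp
      map_mul' := fun c d => by simp [zpow_add, Finset.prod_mul_distrib] }
  have hU : ∀ c : Fin s → ℤ, U (Multiplicative.ofAdd c) = ∏ i, u i ^ c i := fun c => rfl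
  have hdiff : ∀ a b : Fin s →₀ ℕ, U (Multiplicative.ofAdd (expDiff a b)) = 1 ↔
      θ (monomial a 1) = θ (monomial b 1) := fun a b => by
    rw [hmon, hmon, Units.val_inj, hU]
    simp only [expDiff, zpow_sub, zpow_natCast, Finset.prod_mul_distrib, Finset.prod_inv_distrib]
    exact mul_inv_eq_one
  have hker : ∀ c : Fin s → ℤ, ∑ i, c i • lift v i = 0 → U (Multiplicative.ofAdd c) = 1 :=
    fun c hc => by
      obtain ⟨a, b, rfl⟩ := exists_expDiff_eq c
      rw [hdiff, ← sub_eq_zero, ← map_sub]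
      rw [sum_expDiff_smul, sub_eq_zero] at hc
      exact hθQ _ (Ideal.mem_sup_left (Ideal.subset_span ⟨a, b, hc, rfl⟩))
  have hpow : ∀ i, u i ^ (q - 1) = u 0 ^ (q - 1) := fun i => by
    by_cases hi : i = 0
    · rw [hi]
    · rw [← Units.val_inj, Units.val_pow_eq_pow_val, Units.val_pow_eq_pow_val, hu, hu, ← map_pow,
        ← map_pow, ← sub_eq_zero, ← map_sub]
      exact hθQ _ (Ideal.mem_sup_right (Ideal.subset_span ⟨i, hi, rfl⟩))
  obtain ⟨d, hd, hc⟩ := mem_powerLattice.1 hab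
  have hUd : U (Multiplicative.ofAdd (((q - 1 : ℕ) : ℤ) • d)) = 1 := by
    rw [hU]
    simp only [Pi.smul_apply, smul_eq_mul, zpow_mul, zpow_natCast, hpow]
    rw [prod_zpow_eq_zpow_sum, hd, zpow_zero]
  have hUc : U (Multiplicative.ofAdd (expDiff a b - ((q - 1 : ℕ) : ℤ) • d)) = 1 := by
    refine hker _ ?_
    simp only [Pi.sub_apply, Pi.smul_apply, sub_smul, Finset.sum_sub_distrib, hc, smul_assoc,
      ← Finset.smul_sum, sub_self]
  have hfin : θ (monomial a 1) = θ (monomial b 1) := by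
    rw [← hdiff, ← sub_add_cancel (expDiff a b) (((q - 1 : ℕ) : ℤ) • d), ofAdd_add, map_mul, hUc,
      hUd, one_mul]
  obtain ⟨⟨_, m, rfl⟩, hm⟩ :=
    (IsLocalization.eq_iff_exists (Submonoid.powers (Ideal.Quotient.mk Q h)) L).1 hfin
  have hm' : Ideal.Quotient.mk Q h ^ m * Ideal.Quotient.mk Q (monomial a 1) =
    Ideal.Quotient.mk Q h ^ m * Ideal.Quotient.mk Q (monomial b 1) := hm
  -- The exponent is raised by one because the saturation asks for a positive power.
  refine ⟨m + 1, by omega, ?_⟩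
  rw [pow_succ, ← mul_assoc]
  refine Ideal.mul_mem_right _ _ (Ideal.Quotient.eq_zero_iff_mem.1 ?_)
  change Ideal.Quotient.mk Q (_ * h ^ m) = 0
  rw [mul_comm, map_mul, map_pow, map_sub, mul_sub, hm', sub_self]

theorem saturatedIdeal_eq_span [NeZero s] (q : ℕ) (v : Fin s → Fin n → ℤ) :
    saturatedIdeal K q v = Ideal.span {f | ∃ a b : Fin s →₀ ℕ,
      expDiff a b ∈ powerLattice v (q - 1) ∧
        f = monomial a (1 : K) - monomial b (1 : K)} := by
  classical
  refine le_antisymm (fun f hf => ?_) (Ideal.span_le.2 ?_)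
  · refine Ideal.span_mono ?_ (mem_span_binomials
      (fun a => ∑ i, a i • (powerLattice v (q - 1)).mkQ (Pi.single i 1)) f
      (sum_coeff_fiber_of_gradingHom_eq_zero _ (gradingHom_eq_zero_of_mem_saturatedIdeal K q v hf)))
    rintro _ ⟨a, -, b, -, hab, rfl⟩
    exact ⟨a, b, (sum_smul_mk_eq_iff v _ a b).1 hab, rfl⟩
  · rintro _ ⟨a, b, hab, rfl⟩
    exact binomial_mem_saturatedIdeal K q v hab

variable {K}

theorem expDiff_mem_of_binomial_mem_saturatedIdeal [NeZero s] (q : ℕ) (v : Fin s → Fin n → ℤ)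
    {a b : Fin s →₀ ℕ} (h : monomial a (1 : K) - monomial b (1 : K) ∈ saturatedIdeal K q v) :
    expDiff a b ∈ powerLattice v (q - 1) := by
  have h0 := gradingHom_eq_zero_of_mem_saturatedIdeal K q v h
  rw [map_sub, sub_eq_zero, gradingHom_monomial, gradingHom_monomial] at h0
  exact (sum_smul_mk_eq_iff v _ a b).1 (AddMonoidAlgebra.single_left_injective one_ne_zero h0)

end Lattice

/-! ### Polynomials vanishing on the toric set -/

section Vanishing

variable {s n : ℕ} {K : Type*} [Field K]

/-- The character `x ↦ x^w` of the torus `(K^*)^n`, with values in `K`. -/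
def laurentCharacter (K : Type*) [Field K] (w : Fin n → ℤ) : (Fin n → Kˣ) →* K :=
  (Units.coeHom K).comp
    { toFun := fun x => ∏ j, x j ^ w j
      map_one' := by simp
      map_mul' := fun x y => by simp [mul_zpow, Finset.prod_mul_distrib] }

theorem laurentCharacter_apply (w : Fin n → ℤ) (x : Fin n → Kˣ) :
    laurentCharacter K w x = ((∏ j, x j ^ w j : Kˣ) : K) := rfl

theorem eval_monomialPoint_monomial (v : Fin s → Fin n → ℤ) (x : Fin n → Kˣ) (a : Fin s →₀ ℕ)
    (c : K) : eval (monomialPoint v x) (monomial a c) =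
      c * laurentCharacter K (∑ i, a i • v i) x := by
  rw [eval_monomial, Finsupp.prod_fintype _ _ fun i => pow_zero _, laurentCharacter_apply]
  have h : ∏ i, (∏ j, x j ^ v i j) ^ a i = ∏ j, x j ^ (∑ i, a i • v i) j := by
    have hpow : ∀ i, (∏ j, x j ^ v i j) ^ a i = ∏ j, x j ^ (a i • v i) j := fun i => by
      rw [← Finset.prod_pow]
      refine Finset.prod_congr rfl fun j _ => ?_
      rw [← zpow_natCast, ← zpow_mul, mul_comm, Pi.smul_apply, nsmul_eq_mul]
    simp only [hpow, Finset.sum_apply, ← prod_zpow_eq_zpow_sum]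
    exact Finset.prod_comm
  rw [← h, Units.coe_prod]
  simp only [monomialPoint, Units.val_pow_eq_pow_val]

/-- Two Laurent monomials agree on the torus over a finite field with `q` elements exactly when
their exponents agree modulo `q - 1`, because `K^*` is cyclic of order `q - 1`. -/
theorem laurentCharacter_eq_iff [Fintype K] (w w' : Fin n → ℤ) :
    laurentCharacter K w = laurentCharacter K w' ↔
      ∃ u : Fin n → ℤ, w - w' = ((Fintype.card K - 1 : ℕ) : ℤ) • u := by
  classical
  constructor
  · intro h
    obtain ⟨z, hz⟩ := IsCyclic.exists_ofOrder_eq_natCard (α := Kˣ)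
    have hdvd : ∀ j, ((Fintype.card K - 1 : ℕ) : ℤ) ∣ w j - w' j := fun j => by
      have hj := DFunLike.congr_fun h (Pi.mulSingle j z)
      rw [laurentCharacter_apply, laurentCharacter_apply, Units.val_inj] at hj
      have hone : ∀ w : Fin n → ℤ, ∏ i, (Pi.mulSingle j z : Fin n → Kˣ) i ^ w i = z ^ w j :=
        fun w => by
          rw [Finset.prod_eq_single j (fun i _ hi => by simp [hi]) (by simp), Pi.mulSingle_eq_same]
      rw [hone, hone, ← mul_inv_eq_one, ← zpow_sub] at hj
      rw [← Fintype.card_units, ← Nat.card_eq_fintype_card, ← hz]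
      exact orderOf_dvd_iff_zpow_eq_one.2 hj
    choose u hu using hdvd
    exact ⟨u, funext hu⟩
  · rintro ⟨u, hu⟩
    refine MonoidHom.ext fun x => ?_
    rw [laurentCharacter_apply, laurentCharacter_apply, Units.val_inj]
    refine Finset.prod_congr rfl fun j _ => ?_
    rw [← mul_inv_eq_one, ← zpow_sub, ← Pi.sub_apply, hu, Pi.smul_apply, smul_eq_mul, zpow_mul,
      zpow_natCast, ← Fintype.card_units, pow_card_eq_one, one_zpow]

theorem eval_smul_of_isHomogeneous {f : MvPolynomial (Fin s) K} {d : ℕ} (hd : f.IsHomogeneous d)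
    (c : K) (x : Fin s → K) : eval (c • x) f = c ^ d * eval x f := by
  rw [eval_eq', eval_eq', Finset.mul_sum]
  refine Finset.sum_congr rfl fun a ha => ?_
  have hdeg : ∑ i, a i = d := by
    rw [← Finsupp.degree_eq_sum, Finsupp.degree_eq_weight_one]
    exact hd (mem_support_iff.1 ha)
  simp only [Pi.smul_apply, smul_eq_mul, mul_pow, Finset.prod_mul_distrib,
    Finset.prod_pow_eq_pow_sum, hdeg]
  ring

variable [NeZero s]

theorem vanishes_on_algebraicToricSet_iff (v : Fin s → Fin n → ℤ) {f : MvPolynomial (Fin s) K}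
    {d : ℕ} (hd : f.IsHomogeneous d) :
    (∀ (x : Fin s → K) (hx : x ≠ 0), Projectivization.mk K x hx ∈ algebraicToricSet K v →
      eval x f = 0) ↔ ∀ x : Fin n → Kˣ, eval (monomialPoint v x) f = 0 := by
  refine ⟨fun h x => h _ (monomialPoint_ne_zero v x) ⟨x, rfl⟩, ?_⟩
  rintro h y hy ⟨x, hx⟩
  obtain ⟨c, hc⟩ := (Projectivization.mk_eq_mk_iff' K _ _ _ _).1 hx.symm
  rw [← hc, eval_smul_of_isHomogeneous hd, h x, mul_zero]

theorem binomial_mem_vanishingIdeal [Fintype K] (v : Fin s → Fin n → ℤ) {a b : Fin s →₀ ℕ}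
    (hdeg : a.degree = b.degree)
    (h : ∃ u : Fin n → ℤ, ∑ i, a i • v i - ∑ i, b i • v i =
      ((Fintype.card K - 1 : ℕ) : ℤ) • u) :
    monomial a (1 : K) - monomial b (1 : K) ∈ vanishingIdeal K (algebraicToricSet K v) := by
  have hhom : (monomial a (1 : K) - monomial b (1 : K)).IsHomogeneous a.degree :=
    (isHomogeneous_monomial 1 rfl).sub (isHomogeneous_monomial 1 hdeg.symm)
  refine Ideal.subset_span ⟨⟨_, hhom⟩, (vanishes_on_algebraicToricSet_iff v hhom).2 fun x => ?_⟩
  rw [map_sub, eval_monomialPoint_monomial, eval_monomialPoint_monomial,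
    (laurentCharacter_eq_iff _ _).2 h, sub_self]

/-- The vanishing ideal is contained in every ideal that contains the binomials `t^a - t^b` of equal
degree whose exponents parameterize the same Laurent monomial modulo `q - 1`. This rests on the
linear independence of the characters of `(K^*)^n`. -/
theorem vanishingIdeal_le [Fintype K] (v : Fin s → Fin n → ℤ) (J : Ideal (MvPolynomial (Fin s) K))
    (hJ : ∀ a b : Fin s →₀ ℕ, a.degree = b.degree →
      (∃ u : Fin n → ℤ, ∑ i, a i • v i - ∑ i, b i • v i =
        ((Fintype.card K - 1 : ℕ) : ℤ) • u) →
      monomial a (1 : K) - monomial b (1 : K) ∈ J) :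
    vanishingIdeal K (algebraicToricSet K v) ≤ J := by
  classical
  refine Ideal.span_le.2 ?_
  rintro f ⟨⟨d, hd⟩, hf⟩
  rw [vanishes_on_algebraicToricSet_iff v hd] at hf
  let χ : (Fin s →₀ ℕ) → ((Fin n → Kˣ) →* K) := fun a => laurentCharacter K (∑ i, a i • v i)
  have hsum : ∑ a ∈ f.support, Finsupp.single (χ a) (coeff a f) = 0 := by
    have hli := linearIndependent_iff.1 (linearIndependent_monoidHom (Fin n → Kˣ) K)
    refine hli _ ?_
    rw [map_sum]
    funext x
    have hx := hf x
    rw [f.as_sum, map_sum] at hx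
    simpa [eval_monomialPoint_monomial, Finset.sum_apply, χ] using hx
  have hfib : ∀ t, ∑ a ∈ f.support with χ a = t, coeff a f = 0 := fun t => by
    have ht := DFunLike.congr_fun hsum t
    rw [Finsupp.finsetSum_apply] at ht
    simp only [Finsupp.single_apply] at ht
    rw [Finset.sum_filter]
    simpa using ht
  refine Ideal.span_le.2 ?_ (mem_span_binomials χ f hfib)
  rintro _ ⟨a, ha, b, hb, hab, rfl⟩
  have hdeg : ∀ c ∈ f.support, c.degree = d := fun c hc => by
    rw [Finsupp.degree_eq_weight_one]
    exact hd (mem_support_iff.1 hc)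
  exact hJ a b ((hdeg a ha).trans (hdeg b hb).symm) ((laurentCharacter_eq_iff _ _).1 hab)

end Vanishing

/-! ### Comparison of the two ideals -/

section Comparison

variable {s n : ℕ}

theorem sum_smul_lift (v : Fin s → Fin n → ℤ) (c : Fin s → ℤ) :
    ∑ i, c i • lift v i = Fin.snoc (α := fun _ => ℤ) (∑ i, c i • v i) (∑ i, c i) := by
  funext j
  refine Fin.lastCases ?_ (fun j => ?_) j <;> simp [lift, Finset.sum_apply]

theorem sum_eq_of_sum_smul_lift_eq_snoc {v : Fin s → Fin n → ℤ} {c : Fin s → ℤ} {u : Fin n → ℤ}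
    {r : ℤ} (h : ∑ i, c i • lift v i = Fin.snoc (α := fun _ => ℤ) u r) : ∑ i, c i = r := by
  have := congrFun ((sum_smul_lift v c).symm.trans h) (Fin.last n)
  simpa using this

theorem smul_snoc_zero (m : ℤ) (u : Fin n → ℤ) :
    m • (Fin.snoc (α := fun _ => ℤ) u 0 : Fin (n + 1) → ℤ) =
      Fin.snoc (α := fun _ => ℤ) (m • u) 0 := by
  funext j
  refine Fin.lastCases ?_ (fun j => ?_) j <;> simp

theorem sum_expDiff_eq_zero_iff (a b : Fin s →₀ ℕ) :
    ∑ i, expDiff a b i = 0 ↔ a.degree = b.degree := by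
  rw [Finsupp.degree_eq_sum, Finsupp.degree_eq_sum, ← @Nat.cast_inj ℤ]
  simp [expDiff, sub_eq_zero]

/-- This says that `powerLattice v e` is contained in the lattice of the vanishing ideal. The
converse inclusion `mem_powerLattice_of_notMem_zeroDivisors` needs `e` not to be a zero divisor. -/
theorem sum_eq_zero_of_mem_powerLattice {v : Fin s → Fin n → ℤ} {e : ℕ} {c : Fin s → ℤ}
    (hc : c ∈ powerLattice v e) :
    ∑ i, c i = 0 ∧ ∃ u : Fin n → ℤ, ∑ i, c i • v i = (e : ℤ) • u := by
  obtain ⟨d, hd, h⟩ := mem_powerLattice.1 hc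
  rw [sum_smul_lift v d, hd, smul_snoc_zero] at h
  refine ⟨sum_eq_of_sum_smul_lift_eq_snoc h, ∑ i, d i • v i, ?_⟩
  rw [sum_smul_lift] at h
  exact (Fin.snoc_injective2 h).1

theorem mk_lattice_eq_zero_iff (v : Fin s → Fin n → ℤ) (u : Fin (n + 1) → ℤ) :
    (lattice (lift v)).mkQ u = 0 ↔ ∃ d : Fin s → ℤ, ∑ i, d i • lift v i = u := by
  rw [Submodule.mkQ_apply, Submodule.Quotient.mk_eq_zero, lattice,
    Submodule.mem_span_range_iff_exists_fun]

theorem mem_powerLattice_of_notMem_zeroDivisors {v : Fin s → Fin n → ℤ} {e : ℕ}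
    (he : (e : ℤ) ∉ zeroDivisors ℤ ((Fin (n + 1) → ℤ) ⧸ lattice (lift v))) {c : Fin s → ℤ}
    (hc : ∑ i, c i = 0) (hu : ∃ u : Fin n → ℤ, ∑ i, c i • v i = (e : ℤ) • u) :
    c ∈ powerLattice v e := by
  obtain ⟨u, hu⟩ := hu
  have hφ : ∑ i, c i • lift v i = (e : ℤ) • Fin.snoc (α := fun _ => ℤ) u 0 := by
    rw [sum_smul_lift, hc, hu, smul_snoc_zero]
  have hmem : (lattice (lift v)).mkQ (Fin.snoc (α := fun _ => ℤ) u 0) = 0 := by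
    by_contra hne
    refine he ⟨_, hne, ?_⟩
    rw [← map_smul, mk_lattice_eq_zero_iff]
    exact ⟨c, hφ⟩
  obtain ⟨d, hd⟩ := (mk_lattice_eq_zero_iff v _).1 hmem
  exact mem_powerLattice.2 ⟨d, sum_eq_of_sum_smul_lift_eq_snoc hd, by rw [hφ, hd]⟩

variable {K : Type*} [Field K] [Fintype K] [NeZero s]

theorem saturatedIdeal_le_vanishingIdeal (v : Fin s → Fin n → ℤ) :
    saturatedIdeal K (Fintype.card K) v ≤ vanishingIdeal K (algebraicToricSet K v) := by
  rw [saturatedIdeal_eq_span, Ideal.span_le]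
  rintro _ ⟨a, b, hab, rfl⟩
  obtain ⟨h0, hu⟩ := sum_eq_zero_of_mem_powerLattice hab
  rw [sum_expDiff_smul] at hu
  exact binomial_mem_vanishingIdeal v ((sum_expDiff_eq_zero_iff a b).1 h0) hu

theorem saturatedIdeal_eq_vanishingIdeal_iff (v : Fin s → Fin n → ℤ) :
    saturatedIdeal K (Fintype.card K) v = vanishingIdeal K (algebraicToricSet K v) ↔
      ((Fintype.card K - 1 : ℕ) : ℤ) ∉
        zeroDivisors ℤ ((Fin (n + 1) → ℤ) ⧸ lattice (lift v)) := by
  constructor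
  · rintro heq ⟨m, hm, hem⟩
    obtain ⟨w, rfl⟩ := Submodule.mkQ_surjective _ m
    have he : ((Fintype.card K - 1 : ℕ) : ℤ) ≠ 0 := by
      have := Fintype.one_lt_card (α := K)
      omega
    rw [← map_smul, mk_lattice_eq_zero_iff] at hem
    obtain ⟨c, hc⟩ := hem
    -- A multiple of `(v_1, 1)` is subtracted to make the last coordinate of `w` zero.
    let k : ℤ := w (Fin.last n)
    let u : Fin n → ℤ := fun j => w j.castSucc - k * v 0 j
    have hw : w = Fin.snoc (α := fun _ => ℤ) u 0 + k • lift v 0 := by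
      funext j
      refine Fin.lastCases ?_ (fun j => ?_) j <;> simp [lift, u, k]
    have hu : ∑ i, (c - (((Fintype.card K - 1 : ℕ) : ℤ) * k) • Pi.single 0 1 : Fin s → ℤ) i •
        lift v i = Fin.snoc (α := fun _ => ℤ) (((Fintype.card K - 1 : ℕ) : ℤ) • u) 0 := by
      have hsingle : ∑ i, (Pi.single 0 1 : Fin s → ℤ) i • lift v i = lift v 0 := by
        simp [Pi.single_apply]
      simp only [Pi.sub_apply, Pi.smul_apply, sub_smul, Finset.sum_sub_distrib, smul_assoc,
        ← Finset.smul_sum, hsingle, hc]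
      rw [← smul_snoc_zero, hw, smul_add, smul_smul, add_sub_cancel_right]
    obtain ⟨a, b, hab⟩ :=
      exists_expDiff_eq (c - (((Fintype.card K - 1 : ℕ) : ℤ) * k) • Pi.single 0 1)
    rw [← hab] at hu
    have hdeg := sum_eq_of_sum_smul_lift_eq_snoc hu
    have hmem := binomial_mem_vanishingIdeal (K := K) v ((sum_expDiff_eq_zero_iff a b).1 hdeg)
      ⟨u, by
        rw [← sum_expDiff_smul]
        rw [sum_smul_lift] at hu
        exact (Fin.snoc_injective2 hu).1⟩
    rw [← heq] at hmem
    obtain ⟨d, -, hd⟩ :=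
      mem_powerLattice.1 (expDiff_mem_of_binomial_mem_saturatedIdeal _ v hmem)
    rw [hu, ← smul_snoc_zero] at hd
    have hud := smul_right_injective _ he hd
    refine hm ?_
    rw [hw, map_add, map_smul, (mk_lattice_eq_zero_iff v _).2 ⟨d, hud.symm⟩,
      (mk_lattice_eq_zero_iff v (lift v 0)).2 ⟨Pi.single 0 1, by simp [Pi.single_apply]⟩, smul_zero,
      add_zero]
  · intro he
    refine le_antisymm (saturatedIdeal_le_vanishingIdeal v) (vanishingIdeal_le v _ ?_)
    intro a b hab hu
    rw [← sum_expDiff_smul] at hu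
    exact binomial_mem_saturatedIdeal K _ v (mem_powerLattice_of_notMem_zeroDivisors he
      ((sum_expDiff_eq_zero_iff a b).2 hab) hu)

end Comparison

/-- A nonzero integer can only be a zero divisor on a module with torsion; in the torsion-free case
there are no primes dividing an invariant factor. -/
theorem notMem_zeroDivisors_iff (M : Type*) [AddCommGroup M] [AddGroup.FG M] {q : ℕ} (hq : 1 < q) :
    ((q - 1 : ℕ) : ℤ) ∉ zeroDivisors ℤ M ↔
      Submodule.torsion ℤ M = ⊥ ∨ ∀ p ∈ invariantFactorPrimes M, ¬ q ≡ 1 [MOD p] := by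
  have hdvd : ∀ p, q ≡ 1 [MOD p] ↔ p ∣ q - 1 := fun p => by
    rw [Nat.ModEq.comm, Nat.modEq_iff_dvd' hq.le]
  have hne : q - 1 ≠ 0 := by omega
  simp only [hdvd]
  constructor
  · intro h
    rw [mem_zeroDivisors_iff_exists_prime M hne] at h
    push Not at h
    exact Or.inr h
  · rintro (h | h)
    · rintro ⟨m, hm, hqm⟩
      refine hm ?_
      rw [← Submodule.mem_bot ℤ, ← h]
      exact ⟨⟨_, mem_nonZeroDivisors_of_ne_zero (by exact_mod_cast hne)⟩, hqm⟩
    · rw [mem_zeroDivisors_iff_exists_prime M hne]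
      push Not
      exact h

end ToricSet

theorem mainTheorem4 {K : Type*} [Field K] [Fintype K] (q : ℕ) (hq : Fintype.card K = q)
    {s n : ℕ} [NeZero s] (v : Fin s → Fin n → ℤ) :
    (ToricSet.saturatedIdeal K q v ≤
        ToricSet.vanishingIdeal K (ToricSet.algebraicToricSet K v)) ∧
    (ToricSet.saturatedIdeal K q v =
          ToricSet.vanishingIdeal K (ToricSet.algebraicToricSet K v) ↔
        (q : ℤ) - 1 ∉ ToricSet.zeroDivisors ℤ
          ((Fin (n + 1) → ℤ) ⧸ ToricSet.lattice (ToricSet.lift v))) ∧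
    (ToricSet.saturatedIdeal K q v =
          ToricSet.vanishingIdeal K (ToricSet.algebraicToricSet K v) ↔
        (Submodule.torsion ℤ ((Fin (n + 1) → ℤ) ⧸ ToricSet.lattice (ToricSet.lift v)) = ⊥ ∨
          ∀ p ∈ ToricSet.invariantFactorPrimes
              ((Fin (n + 1) → ℤ) ⧸ ToricSet.lattice (ToricSet.lift v)),
            ¬ q ≡ 1 [MOD p])) := by
  subst hq
  have hcard : 1 < Fintype.card K := Fintype.one_lt_card
  have hfg : AddGroup.FG ((Fin (n + 1) → ℤ) ⧸ ToricSet.lattice (ToricSet.lift v)) :=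
    Module.Finite.iff_addGroup_fg.1 inferInstance
  have hiff := ToricSet.saturatedIdeal_eq_vanishingIdeal_iff (K := K) v
  refine ⟨ToricSet.saturatedIdeal_le_vanishingIdeal v, ?_,
    hiff.trans (ToricSet.notMem_zeroDivisors_iff _ hcard)⟩
  rwa [Nat.cast_sub hcard.le, Nat.cast_one] at hiff
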